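/- Let $K$ be a field with $\operatorname{char} K \neq 2$, let $F$ be the free group on a countably infinite alphabet, and let $KF$ be its group algebra. An element $u = u(x_1,\dots,x_n) \in KF$ is an identity of a representation $\rho : G \to \operatorname{Aut}_K V$ of a group $G$ over $K$ if for all $g_1,\dots,g_n \in G$ the element $u(g_1,\dots,g_n) \in KG$ annihilates $V$. A set $U$ of identities of $\rho$ is a basis of identities of $\rho$ if the representations of groups over $K$ that satisfy all identities in $U$ are exactly those that satisfy all identities of $\rho$. Write $x^y = y^{-1}xy$ and $x^{2y} = (x^2)^y$. Then the following three elements of $KF$, in which distinct symbols within one element denote distinct letters of the alphabet, form a basis of identities of the regular representation $\operatorname{Reg}_K D_8 = (KD_8, D_8)$ of the dihedral group $D_8$ of order $8$: $$\prod_{0 \le i < j \le 8} \bigl((x_i x_j^{-1})^{y_{ij}} - 1\bigr),$$ $$x^4 - 1,$$ $$(x_1^{2y_1} - 1)(x_2^{2y_2} - 1)(x_3^{2y_3} - 1)\bigl((x_1x_2^{-1})^{y_4} - 1\bigr)\bigl((x_1x_3^{-1})^{y_5} - 1\bigr)\bigl((x_2x_3^{-1})^{y_6} - 1\bigr).$$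 Here the factors of the first product may be multiplied in any fixed order. -/

import Mathlib

/-! Identities of group representations over a field. -/

universe uK uH uW uG uV

namespace RepIdentities

/-- The free group `F` on the countable alphabet `X 0, X 1, X 2, …`. -/
abbrev F : Type := FreeGroup ℕ

/-- The `n`-th letter of the alphabet. -/
abbrev X (n : ℕ) : F := FreeGroup.of n

/-- `u(g₀, g₁, …) ∈ KG`: the image of `u ∈ KF` under the algebra homomorphism `KF → KG` which
extends the group homomorphism `F → G` sending the `i`-th letter to `g i`. -/
noncomputable def subst {K G : Type*} [Field K] [Group G] (g : ℕ → G)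
    (u : MonoidAlgebra K F) : MonoidAlgebra K G :=
  MonoidAlgebra.mapDomainAlgHom K K (FreeGroup.lift g) u

/-- `u ∈ KF` is an identity of the representation `ρ = (V, G)` if for all elements `g i` of `G`
the element `u(g₀, g₁, …)` of `KG` annihilates `V`. -/
def IsIdentity {K G V : Type*} [Field K] [Group G] [AddCommGroup V] [Module K V]
    (ρ : Representation K G V) (u : MonoidAlgebra K F) : Prop :=
  ∀ (g : ℕ → G) (v : V), ρ.asAlgebraHom (subst g u) v = 0

/-- Membership of `σ` in the variety of group representations defined by the set `U ⊆ KF`. -/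
def InVarietyDefinedBy {K G V : Type*} [Field K] [Group G] [AddCommGroup V] [Module K V]
    (U : Set (MonoidAlgebra K F)) (σ : Representation K G V) : Prop :=
  ∀ u ∈ U, IsIdentity σ u

/-- The set of all identities of `ρ`; the variety generated by `ρ` is the one it defines. -/
def identitiesOf {K G V : Type*} [Field K] [Group G] [AddCommGroup V] [Module K V]
    (ρ : Representation K G V) : Set (MonoidAlgebra K F) :=
  {u | IsIdentity ρ u}

/-- `U` is a basis of identities of `ρ`: the elements of `U` are identities of `ρ`, and the
variety of group representations over `K` defined by `U` is the variety generated by `ρ`. -/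
def IsBasisOfIdentities {K : Type uK} {H : Type uH} {W : Type uW} [Field K] [Group H]
    [AddCommGroup W] [Module K W] (ρ : Representation K H W)
    (U : Set (MonoidAlgebra K F)) : Prop :=
  U ⊆ identitiesOf ρ ∧
    ∀ (G : Type uG) (V : Type uV) [Group G] [AddCommGroup V] [Module K V]
      (σ : Representation K G V),
      InVarietyDefinedBy U σ ↔ InVarietyDefinedBy (identitiesOf ρ) σ

/-- The conjugate `x ^ y = y⁻¹ x y`. -/
def conjBy (x y : F) : F := y⁻¹ * x * y

/-- The element `w - 1` of `KF`, for a word `w ∈ F`. -/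
noncomputable def minusOne (K : Type*) [Field K] (w : F) : MonoidAlgebra K F :=
  MonoidAlgebra.of K F w - 1

/-- The product of the `(xᵢ xⱼ⁻¹)^{yᵢⱼ} - 1` over the pairs `(i, j)` in the list `l`, in the order
of the list. Here `xᵢ` is the letter number `i ≤ 8` and `yᵢⱼ` the letter number `9 + 9 i + j`. -/
noncomputable def omegaStar (K : Type*) [Field K] (l : List (Fin 9 × Fin 9)) :
    MonoidAlgebra K F :=
  (l.map fun p => minusOne K
    (conjBy (X p.1 * (X p.2)⁻¹) (X (9 + 9 * (p.1 : ℕ) + (p.2 : ℕ))))).prod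

/-- The element `x⁴ - 1`. -/
noncomputable def expStar (K : Type*) [Field K] : MonoidAlgebra K F :=
  minusOne K (X 0 ^ 4)

/-- The element
`(x₁^{2y₁} - 1)(x₂^{2y₂} - 1)(x₃^{2y₃} - 1)((x₁x₂⁻¹)^{y₄} - 1)((x₁x₃⁻¹)^{y₅} - 1)((x₂x₃⁻¹)^{y₆} - 1)`,
where `x₁, x₂, x₃` are the letters number `1, 2, 3` and `y₁, …, y₆` the letters number
`4, …, 9`. -/
noncomputable def threeStar (K : Type*) [Field K] : MonoidAlgebra K F :=
  minusOne K (conjBy (X 1 ^ 2) (X 4)) *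
  minusOne K (conjBy (X 2 ^ 2) (X 5)) *
  minusOne K (conjBy (X 3 ^ 2) (X 6)) *
  minusOne K (conjBy (X 1 * (X 2)⁻¹) (X 7)) *
  minusOne K (conjBy (X 1 * (X 3)⁻¹) (X 8)) *
  minusOne K (conjBy (X 2 * (X 3)⁻¹) (X 9))

end RepIdentities

/-!
An element of `KF` is an identity of a representation of `G` exactly when all its values lie in the
annihilator `I` of the representation in `K[G]`, and since it involves finitely many letters, `G`
may be taken free of finite rank. Then `G` has finitely many homomorphisms to `D₈`; let `N` be the
intersection of their kernels.

Let `I` contain the values of the three elements. A prime ideal `P ⊇ I` contains all products of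
independent conjugates of given elements only if it contains one of these elements. Hence the image
`Q` of `G` in `K[G] ⧸ P` has at most `8` elements, exponent dividing `4`, at most two elements with
a nontrivial square, and a cyclic centre, as the centre of `K[G] ⧸ P` is a domain. Such a group
embeds in `D₈`, so `P` contains the kernel of `K[G] → K[D₈]` for some homomorphism `G → D₈`.

Taking for `P` the annihilators of the simple modules `K[G] ⧸ m` with `m ⊇ I`, we see that `N` is
trivial modulo the Jacobson radical of `I`, and therefore modulo `I`, because `x⁴ - 1` is in `I` and
`4` is invertible. So `K[G] ⧸ I` is a quotient of `K[G ⧸ N]`, which is semisimple by Maschke's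
theorem, and `I` is the intersection of the maximal left ideals `m ⊇ I`, each of which contains all
values of the identities of `D₈`.
-/

namespace RepIdentities

open scoped MonoidAlgebra

section Ring

variable {R : Type*} [Ring R]

theorem sub_one_mem_of_mem_jacobson {I : Ideal R} [I.IsTwoSided] {t : R} {e : ℕ}
    (he : IsUnit (e : R)) (hpow : t ^ e - 1 ∈ I) (ht : t - 1 ∈ I.jacobson) : t - 1 ∈ I := by
  -- `a` is congruent to the unit `e` modulo the radical, so it can be cancelled from `t ^ e - 1`.
  set a := ∑ i ∈ Finset.range e, t ^ i
  have ha : a - e ∈ I.jacobson := by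
    have hsum : a - e = ∑ i ∈ Finset.range e, (t ^ i - 1) := by
      simp [a, Finset.sum_sub_distrib]
    rw [hsum]
    exact sum_mem fun i _ => geom_sum_mul t i ▸ Ideal.mul_mem_left _ _ ht
  obtain ⟨c, hc⟩ := he.exists_left_inv
  have hca : c * a - 1 ∈ I.jacobson := by
    rw [← hc, ← mul_sub]
    exact Ideal.mul_mem_left _ _ ha
  obtain ⟨s, hs⟩ := Ideal.exists_mul_sub_mem_of_sub_one_mem_jacobson _ hca
  have hcancel : t - 1 = s * c * (t ^ e - 1) - (s * (c * a) - 1) * (t - 1) := by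
    rw [← geom_sum_mul]
    noncomm_ring
  rw [hcancel]
  exact sub_mem (Ideal.mul_mem_left _ _ hpow) (Ideal.mul_mem_right _ _ hs)

theorem jacobson_eq_self_of_isSemisimpleModule_quotient (I : Ideal R)
    [IsSemisimpleModule R (R ⧸ I)] : I.jacobson = I := by
  refine le_antisymm (fun x hx => ?_) Ideal.le_jacobson
  suffices I.mkQ x ∈ Module.jacobson R (R ⧸ I) by
    rwa [IsSemisimpleModule.jacobson_eq_bot, Submodule.mem_bot, Submodule.mkQ_apply,
      Submodule.Quotient.mk_eq_zero] at this
  refine Submodule.mem_sInf.2 fun N (hN : IsCoatom N) => ?_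
  have hmax : IsCoatom (N.comap I.mkQ) :=
    (Submodule.isCoatom_comap_iff I.mkQ_surjective).2 hN
  exact Submodule.mem_sInf.1 hx _ ⟨Submodule.le_comap_mkQ I N, ⟨hmax⟩⟩

theorem jacobson_eq_self_of_ker_le {S : Type*} [Ring S] [IsSemisimpleRing S] {f : R →+* S}
    (hf : Function.Surjective f) {I : Ideal R} (hI : RingHom.ker f ≤ I) : I.jacobson = I := by
  have hmap : (I.map f).comap f = I := by
    rw [Ideal.comap_map_of_surjective' f hf, sup_eq_left.2 hI]
  rw [← hmap, ← Ideal.comap_jacobson_of_surjective hf,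
      jacobson_eq_self_of_isSemisimpleModule_quotient]

/-- Primeness of an ideal of a not necessarily commutative ring, in terms of elements. -/
structure IsPrimeIdeal (P : Ideal R) : Prop where
  ne_top : P ≠ ⊤
  mem_or_mem {a b : R} (h : ∀ r, a * r * b ∈ P) : a ∈ P ∨ b ∈ P

theorem isPrimeIdeal_annihilator (M : Type*) [AddCommGroup M] [Module R M] [IsSimpleModule R M] :
    IsPrimeIdeal (Module.annihilator R M) where
  ne_top h := by
    have := IsSimpleModule.nontrivial R M
    have := Module.annihilator_eq_top_iff.1 h
    exact not_subsingleton M this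
  mem_or_mem {a b} h := by
    by_contra! ⟨ha, hb⟩
    simp only [Module.mem_annihilator, not_forall] at ha hb
    obtain ⟨⟨m, hm⟩, ⟨n, hn⟩⟩ := And.intro ha hb
    obtain ⟨r, rfl⟩ := IsSimpleModule.toSpanSingleton_surjective R hn m
    apply hm
    simpa only [mul_smul, LinearMap.toSpanSingleton_apply] using Module.mem_annihilator.1 (h r) n

theorem exists_isPrimeIdeal_le {R : Type*} [Ring R] {I m : Ideal R} [I.IsTwoSided]
    (hm : m.IsMaximal) (hIm : I ≤ m) :
    ∃ P : Ideal R, P.IsTwoSided ∧ IsPrimeIdeal P ∧ I ≤ P ∧ P ≤ m := by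
  have : IsSimpleModule R (R ⧸ m) := isSimpleModule_iff_isCoatom.2 hm.out
  refine ⟨Module.annihilator R (R ⧸ m), inferInstance, isPrimeIdeal_annihilator _, ?_, ?_⟩
  · refine fun x hx => Module.mem_annihilator.2 fun y => ?_
    obtain ⟨y, rfl⟩ := Submodule.Quotient.mk_surjective m y
    exact (Submodule.Quotient.mk_eq_zero m).2 (hIm (I.mul_mem_right y hx))
  · intro x hx
    have := Module.mem_annihilator.1 hx (Submodule.Quotient.mk 1)
    rwa [← Submodule.Quotient.mk_smul, Submodule.Quotient.mk_eq_zero, smul_eq_mul, mul_one] at this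

theorem IsPrimeIdeal.isDomain_center_quotient {P : Ideal R} [P.IsTwoSided] (hP : IsPrimeIdeal P) :
    IsDomain (Subring.center (R ⧸ P)) := by
  have : Nontrivial (R ⧸ P) := Ideal.Quotient.nontrivial_iff.2 hP.ne_top
  have : NoZeroDivisors (Subring.center (R ⧸ P)) := by
    refine ⟨fun {x y} hxy => ?_⟩
    obtain ⟨a, ha⟩ := Ideal.Quotient.mk_surjective x.1
    obtain ⟨b, hb⟩ := Ideal.Quotient.mk_surjective y.1
    have hab : ∀ r, a * r * b ∈ P := fun r => by
      rw [← Ideal.Quotient.eq_zero_iff_mem, map_mul, map_mul, ha, hb,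
        ← Subring.mem_center_iff.1 x.2, mul_assoc, ← Subring.coe_mul, hxy, ZeroMemClass.coe_zero,
        mul_zero]
    rcases hP.mem_or_mem hab with h | h
    · left; ext; rw [← ha]; exact Ideal.Quotient.eq_zero_iff_mem.2 h
    · right; ext; rw [← hb]; exact Ideal.Quotient.eq_zero_iff_mem.2 h
  exact NoZeroDivisors.to_isDomain _

end Ring

section GroupAlgebra

variable {K G : Type*} [CommRing K] [Group G]

open MonoidAlgebra (of mapDomain mapDomainAlgHom)

theorem mapDomainAlgHom_surjective {H : Type*} [Group H] {f : G →* H}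
    (hf : Function.Surjective f) : Function.Surjective (mapDomainAlgHom K K f) := by
  intro w
  induction w using MonoidAlgebra.induction_on with
  | of h =>
    obtain ⟨g, rfl⟩ := hf h
    exact ⟨of K G g, MonoidAlgebra.mapDomain_single⟩
  | add v w hv hw =>
    obtain ⟨⟨v, rfl⟩, ⟨w, rfl⟩⟩ := And.intro hv hw
    exact ⟨v + w, map_add _ v w⟩
  | smul c w hw =>
    obtain ⟨w, rfl⟩ := hw
    exact ⟨c • w, map_smul _ c w⟩

theorem mem_of_mapDomainAlgHom_eq_zero {H : Type*} [Group H] {f : G →* H} {I : Ideal K[G]}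
    (hI : ∀ g ∈ f.ker, of K G g - 1 ∈ I) {w : K[G]} (hw : mapDomainAlgHom K K f w = 0) :
    w ∈ I := by
  -- Choosing a representative of each fibre of `f` moves `w` only within its class modulo `I`.
  suffices key : ∀ v : K[G], v - mapDomain (Function.invFun f) (mapDomainAlgHom K K f v) ∈ I by
    simpa [hw] using key w
  intro v
  induction v using MonoidAlgebra.induction_on with
  | of g =>
    set h := Function.invFun f (f g)
    have hfh : f h = f g := Function.invFun_eq ⟨g, rfl⟩
    have hker : h⁻¹ * g ∈ f.ker := by simp [MonoidHom.mem_ker, hfh]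
    have hfactor : of K G g - of K G h = of K G h * (of K G (h⁻¹ * g) - 1) := by
      rw [mul_sub, ← map_mul, mul_inv_cancel_left, mul_one]
    simpa [h] using hfactor ▸ I.mul_mem_left _ (hI _ hker)
  | add x y hx hy =>
    simpa only [map_add, MonoidAlgebra.mapDomain_add, add_sub_add_comm] using add_mem hx hy
  | smul c x hx =>
    simpa only [map_smul, MonoidAlgebra.mapDomain_smul, ← smul_sub] using I.smul_of_tower_mem c hx

theorem IsPrimeIdeal.mem_or_mem_of_forall_of {P : Ideal K[G]} (hP : IsPrimeIdeal P) {a b : K[G]}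
    (h : ∀ y : G, a * of K G y * b ∈ P) : a ∈ P ∨ b ∈ P := by
  refine hP.mem_or_mem fun r => ?_
  induction r using MonoidAlgebra.induction_on with
  | of y => exact h y
  | add x y hx hy => simpa only [mul_add, add_mul] using add_mem hx hy
  | smul c x hx => simpa only [mul_smul_comm, smul_mul_assoc] using P.smul_of_tower_mem c hx

theorem IsPrimeIdeal.exists_mem_of_prod_conj {P : Ideal K[G]} (hP : IsPrimeIdeal P) {ι : Type*}
    (a : ι → K[G]) {l : List ι} (hl : l.Nodup)
    (h : ∀ y : ι → G, (l.map fun i => of K G (y i)⁻¹ * a i * of K G (y i)).prod ∈ P) :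
    ∃ i ∈ l, a i ∈ P := by
  classical
  induction l with
  | nil => exact absurd (P.eq_top_iff_one.2 (by simpa using h 1)) hP.ne_top
  | cons i l ih =>
    obtain ⟨hil, hl⟩ := List.nodup_cons.1 hl
    by_cases hi : a i ∈ P
    · exact ⟨i, List.mem_cons_self, hi⟩
    obtain ⟨j, hj, hjP⟩ := ih hl fun y => by
      refine (hP.mem_or_mem_of_forall_of fun z => ?_).resolve_left hi
      have hupdate : ∀ k ∈ l, Function.update y i z k = y k := fun k hk =>
        Function.update_of_ne (ne_of_mem_of_not_mem hk hil) _ _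
      have hz := P.mul_mem_left (of K G z) (h (Function.update y i z))
      rw [List.map_cons, List.prod_cons, Function.update_self,
        List.map_congr_left fun k hk => by rw [hupdate k hk]] at hz
      simpa only [← mul_assoc, ← map_mul, mul_inv_cancel, map_one, one_mul] using hz
    exact ⟨j, List.mem_cons_of_mem i hj, hjP⟩

/-- The homomorphism from `G` to the algebra `K[G] ⧸ P`. -/
noncomputable def toQuotient (P : Ideal K[G]) [P.IsTwoSided] : G →* K[G] ⧸ P :=
  (Ideal.Quotient.mk P : K[G] →* K[G] ⧸ P).comp (of K G)

/-- The normal subgroup of the elements of `G` which are congruent to `1` modulo `P`: the kernel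
of the action of `G` on `K[G] ⧸ P`. -/
noncomputable abbrev congruenceKer (P : Ideal K[G]) [P.IsTwoSided] : Subgroup G :=
  (toQuotient P).ker

theorem mem_congruenceKer {P : Ideal K[G]} [P.IsTwoSided] {g : G} :
    g ∈ congruenceKer P ↔ of K G g - 1 ∈ P := by
  rw [MonoidHom.mem_ker, ← Ideal.Quotient.mk_eq_mk_iff_sub_mem, map_one]
  rfl

theorem IsPrimeIdeal.isCyclic_center_quotient {P : Ideal K[G]} [P.IsTwoSided]
    (hP : IsPrimeIdeal P) [Finite (G ⧸ congruenceKer P)] :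
    IsCyclic (Subgroup.center (G ⧸ congruenceKer P)) := by
  let φ : G ⧸ congruenceKer P →* K[G] ⧸ P := QuotientGroup.lift _ (toQuotient P) fun _ hg => hg
  have hφ : Function.Injective φ := by
    refine (injective_iff_map_eq_one φ).2 fun q hq => ?_
    obtain ⟨g, rfl⟩ := QuotientGroup.mk_surjective q
    exact (QuotientGroup.eq_one_iff g).2 hq
  have hcenter : ∀ z ∈ Subgroup.center (G ⧸ congruenceKer P), φ z ∈ Subring.center (K[G] ⧸ P) := by
    refine fun z hz => Subring.mem_center_iff.2 fun r => ?_
    obtain ⟨r, rfl⟩ := Ideal.Quotient.mk_surjective r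
    induction r using MonoidAlgebra.induction_on with
    | of g =>
      have hcomm := congrArg φ (Subgroup.mem_center_iff.1 hz (g : G ⧸ congruenceKer P))
      rwa [map_mul, map_mul] at hcomm
    | add x y hx hy => simp only [map_add, add_mul, mul_add, hx, hy]
    | smul c x hx =>
      rw [← Ideal.Quotient.mkₐ_eq_mk K] at hx ⊢
      rw [map_smul, smul_mul_assoc, mul_smul_comm, hx]
  have := hP.isDomain_center_quotient
  let ψ : Subgroup.center (G ⧸ congruenceKer P) →* Subring.center (K[G] ⧸ P) :=
    (φ.comp (Subgroup.subtype _)).codRestrict (Subring.center (K[G] ⧸ P)) fun z => hcenter z z.2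
  exact isCyclic_of_injective_ringHom ψ fun x y hxy =>
    Subtype.ext (hφ (congrArg Subtype.val hxy))

end GroupAlgebra

section Values

variable {K G : Type*} [Field K] [Group G]

open MonoidAlgebra (of mapDomainAlgHom)

/-- All values of `u ∈ KF` in the group algebra `K[G]` belong to the ideal `I`; with `I` the
annihilator of a representation, this says that `u` is an identity of the representation. -/
def HasValuesIn (u : K[F]) (I : Ideal K[G]) : Prop :=
  ∀ g : ℕ → G, subst g u ∈ I

theorem isIdentity_iff_hasValuesIn {V : Type*} [AddCommGroup V] [Module K V]
    {ρ : Representation K G V} {u : K[F]} :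
    IsIdentity ρ u ↔ HasValuesIn u (RingHom.ker ρ.asAlgebraHom) := by
  simp only [IsIdentity, HasValuesIn, RingHom.mem_ker, LinearMap.ext_iff, LinearMap.zero_apply]

theorem isIdentity_leftRegular_iff {u : K[F]} :
    IsIdentity (Representation.leftRegular K G) u ↔ ∀ g : ℕ → G, subst g u = 0 := by
  have hmul (r v : K[G]) : (Representation.leftRegular K G).asAlgebraHom r v = r * v :=
    (Representation.ofMulActionSelfAsModuleEquiv (k := K) (G := G)).map_smul r v
  refine ⟨fun h g => ?_, fun h g v => ?_⟩
  · simpa only [hmul, mul_one] using h g (1 : K[G])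
  · rw [h g, map_zero, LinearMap.zero_apply]

theorem subst_of (g : ℕ → G) (w : F) : subst g (of K F w) = of K G (FreeGroup.lift g w) :=
  MonoidAlgebra.mapDomain_single

theorem subst_minusOne (g : ℕ → G) (w : F) :
    subst g (minusOne K w) = of K G (FreeGroup.lift g w) - 1 := by
  rw [← subst_of, minusOne, subst, map_sub, map_one, subst]

theorem mapDomainAlgHom_subst {H : Type*} [Group H] (f : G →* H) (g : ℕ → G) (u : K[F]) :
    mapDomainAlgHom K K f (subst g u) = subst (f ∘ g) u := by
  have hlift : f.comp (FreeGroup.lift g) = FreeGroup.lift (f ∘ g) := by ext; simp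
  rw [subst, subst, ← hlift, MonoidAlgebra.mapDomainAlgHom_comp, AlgHom.comp_apply]

open Filter

/-- The sequence `g 0, …, g (n - 1), 1, 1, …`. -/
def truncate (g : ℕ → G) (n i : ℕ) : G :=
  if i < n then g i else 1

theorem eventually_lift_truncate_eq (g : ℕ → G) (w : F) :
    ∀ᶠ n in atTop, FreeGroup.lift (truncate g n) w = FreeGroup.lift g w := by
  induction w using FreeGroup.induction_on with
  | C1 => simp
  | of i =>
    filter_upwards [eventually_gt_atTop i] with n hn
    simp [truncate, hn]
  | inv_of i ih => simpa using ih
  | mul v w hv hw =>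
    filter_upwards [hv, hw] with n hv hw
    rw [map_mul, map_mul, hv, hw]

theorem eventually_subst_truncate_eq (g : ℕ → G) (u : K[F]) :
    ∀ᶠ n in atTop, subst (truncate g n) u = subst g u := by
  induction u using MonoidAlgebra.induction_on with
  | of w =>
    filter_upwards [eventually_lift_truncate_eq g w] with n hn
    rw [subst_of, subst_of, hn]
  | add u v hu hv =>
    filter_upwards [hu, hv] with n hu hv
    simp only [subst, map_add] at hu hv ⊢
    rw [hu, hv]
  | smul c u hu =>
    filter_upwards [hu] with n hu
    simp only [subst, map_smul] at hu ⊢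
    rw [hu]

end Values

section Reduction

variable {K G H : Type*} [Field K] [Group G] [Group H]

open MonoidAlgebra (of mapDomainAlgHom)

theorem natCard_range_pi_ne_zero [Finite (G →* H)] (hH : (Nat.card H : K) ≠ 0) :
    (Nat.card (MonoidHom.pi fun f : G →* H => f).range : K) ≠ 0 := by
  have hdvd := Subgroup.card_subgroup_dvd_card (MonoidHom.pi fun f : G →* H => f).range
  rw [Nat.card_fun] at hdvd
  refine ne_zero_of_dvd_ne_zero ?_ (Nat.cast_dvd_cast hdvd)
  rw [Nat.cast_pow]
  exact pow_ne_zero _ hH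

theorem mem_of_forall_mapDomainAlgHom_eq_zero [Finite (G →* H)] (hH : (Nat.card H : K) ≠ 0)
    {I : Ideal K[G]} [I.IsTwoSided]
    (hmax : ∀ m : Ideal K[G], m.IsMaximal → I ≤ m → ∃ f : G →* H, ∀ g ∈ f.ker, of K G g - 1 ∈ m)
    {e : ℕ} (he : (e : K) ≠ 0) (hexp : ∀ g : G, of K G g ^ e - 1 ∈ I)
    {w : K[G]} (hw : ∀ f : G →* H, mapDomainAlgHom K K f w = 0) : w ∈ I := by
  let Φ : G →* (G →* H) → H := MonoidHom.pi fun f => f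
  have heK : IsUnit (e : K[G]) := by
    simpa using (IsUnit.mk0 _ he).map (algebraMap K K[G])
  have hker : ∀ g ∈ Φ.rangeRestrict.ker, of K G g - 1 ∈ I := by
    intro g hg
    rw [MonoidHom.ker_rangeRestrict] at hg
    refine sub_one_mem_of_mem_jacobson heK (hexp g) (Submodule.mem_sInf.2 fun m ⟨hIm, hm⟩ => ?_)
    obtain ⟨f, hf⟩ := hmax m hm hIm
    exact hf g (congrFun (MonoidHom.mem_ker.1 hg) f)
  have : Finite H := Nat.finite_of_card_ne_zero fun h => hH (by rw [h, Nat.cast_zero])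
  have : NeZero (Nat.card Φ.range : K) := ⟨natCard_range_pi_ne_zero hH⟩
  have hsurj : Function.Surjective (mapDomainAlgHom K K Φ.rangeRestrict : K[G] →+* K[Φ.range]) :=
    mapDomainAlgHom_surjective Φ.rangeRestrict_surjective
  rw [← jacobson_eq_self_of_ker_le hsurj fun v hv => mem_of_mapDomainAlgHom_eq_zero hker hv]
  refine Submodule.mem_sInf.2 fun m ⟨hIm, hm⟩ => ?_
  obtain ⟨f, hf⟩ := hmax m hm hIm
  exact mem_of_mapDomainAlgHom_eq_zero hf (hw f)

end Reduction

section General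

variable {K : Type uK} {H : Type uH} [Field K] [Group H]

open MonoidAlgebra (of mapDomainAlgHom)

theorem hasValuesIn_of_forall_isPrimeIdeal {G : Type*} [Group G] [Finite (G →* H)]
    (hH : (Nat.card H : K) ≠ 0)
    {U : Set K[F]} {e : ℕ} (he : (e : K) ≠ 0) (hexp : minusOne K (X 0 ^ e) ∈ U)
    (hprime : ∀ P : Ideal K[G], P.IsTwoSided → IsPrimeIdeal P → (∀ u ∈ U, HasValuesIn u P) →
      ∃ f : G →* H, ∀ g ∈ f.ker, of K G g - 1 ∈ P)
    {I : Ideal K[G]} [I.IsTwoSided] (hI : ∀ u ∈ U, HasValuesIn u I)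
    {u : K[F]} (hu : u ∈ identitiesOf (Representation.leftRegular K H)) : HasValuesIn u I := by
  intro g
  refine mem_of_forall_mapDomainAlgHom_eq_zero hH (fun m hm hIm => ?_) he (fun x => ?_) fun f => ?_
  · obtain ⟨P, hP2, hP, hIP, hPm⟩ := exists_isPrimeIdeal_le hm hIm
    obtain ⟨f, hf⟩ := hprime P hP2 hP fun u hu g => hIP (hI u hu g)
    exact ⟨f, fun g hg => hPm (hf g hg)⟩
  · simpa [subst_minusOne] using hI _ hexp fun _ => x
  · rw [mapDomainAlgHom_subst, isIdentity_leftRegular_iff.1 hu]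

theorem isBasisOfIdentities_leftRegular (hH : (Nat.card H : K) ≠ 0) {U : Set K[F]}
    (hU : U ⊆ identitiesOf (Representation.leftRegular K H))
    {e : ℕ} (he : (e : K) ≠ 0) (hexp : minusOne K (X 0 ^ e) ∈ U)
    (hprime : ∀ (n : ℕ) (P : Ideal K[FreeGroup (Fin n)]), P.IsTwoSided → IsPrimeIdeal P →
      (∀ u ∈ U, HasValuesIn u P) →
      ∃ f : FreeGroup (Fin n) →* H, ∀ g ∈ f.ker, of K (FreeGroup (Fin n)) g - 1 ∈ P) :
    IsBasisOfIdentities.{uK, uH, max uK uH, uG, uV} (Representation.leftRegular K H) U := by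
  refine ⟨hU, fun G V _ _ _ σ => ⟨fun hσ u hu => ?_, fun hσ u hu => hσ u (hU hu)⟩⟩
  have : Finite H := Nat.finite_of_card_ne_zero fun h => hH (by rw [h, Nat.cast_zero])
  refine isIdentity_iff_hasValuesIn.2 fun g => ?_
  obtain ⟨n, hn⟩ := (eventually_subst_truncate_eq g u).exists
  have : Finite (FreeGroup (Fin n) →* H) := Finite.of_equiv _ FreeGroup.lift
  let f : FreeGroup (Fin n) →* G := FreeGroup.lift fun i => g i
  let x : ℕ → FreeGroup (Fin n) := fun i => if hi : i < n then FreeGroup.of ⟨i, hi⟩ else 1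
  have hx : f ∘ x = truncate g n := by
    ext i
    by_cases hi : i < n <;> simp [f, x, truncate, hi]
  let I : Ideal K[FreeGroup (Fin n)] :=
    RingHom.ker (σ.asAlgebraHom.comp (mapDomainAlgHom K K f))
  have hmem {v : K[F]} {y : ℕ → FreeGroup (Fin n)} :
      subst y v ∈ I ↔ subst (f ∘ y) v ∈ RingHom.ker σ.asAlgebraHom := by
    rw [← mapDomainAlgHom_subst]
    rfl
  rw [← hn, ← hx, ← hmem]
  exact hasValuesIn_of_forall_isPrimeIdeal hH he hexp (hprime n)
    (fun v hv y => hmem.2 (isIdentity_iff_hasValuesIn.1 (hσ v hv) _)) hu x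

end General

section ConjProduct

variable {K G : Type*} [Field K] [Group G] {ι : Type*}

open MonoidAlgebra (of)

/-- The product of the `w i ^ y i - 1` over the `i` in the list `l`, in the order of the list,
where `y i` is the letter number `c i`. -/
noncomputable def conjProduct (K : Type*) [Field K] (w : ι → F) (c : ι → ℕ) (l : List ι) : K[F] :=
  (l.map fun i => minusOne K (conjBy (w i) (X (c i)))).prod

/-- Every sequence of elements of `Q` satisfies one of the equations `w i = 1` with `i` in `l`. -/
def SatisfiesDisjunction (Q : Type*) [Group Q] (w : ι → F) (l : List ι) : Prop :=
  ∀ q : ℕ → Q, ∃ i ∈ l, FreeGroup.lift q (w i) = 1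

theorem subst_conjProduct (g : ℕ → G) (w : ι → F) (c : ι → ℕ) (l : List ι) :
    subst g (conjProduct K w c l) = (l.map fun i =>
      of K G (g (c i))⁻¹ * (of K G (FreeGroup.lift g (w i)) - 1) * of K G (g (c i))).prod := by
  have hfactor (i : ι) : subst g (minusOne K (conjBy (w i) (X (c i)))) =
      of K G (g (c i))⁻¹ * (of K G (FreeGroup.lift g (w i)) - 1) * of K G (g (c i)) := by
    rw [subst_minusOne, mul_sub, sub_mul, mul_one, ← map_mul, ← map_mul, ← map_mul,
      inv_mul_cancel, map_one]
    simp [conjBy]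
  simp only [← hfactor]
  rw [conjProduct, subst, map_list_prod, List.map_map]
  rfl

theorem SatisfiesDisjunction.conjProduct_mem_identitiesOf {w : ι → F} {l : List ι}
    (h : SatisfiesDisjunction G w l) (c : ι → ℕ) {V : Type*} [AddCommGroup V] [Module K V]
    (ρ : Representation K G V) : conjProduct K w c l ∈ identitiesOf ρ := by
  intro g v
  obtain ⟨i, hi, hgi⟩ := h g
  have hzero : subst g (conjProduct K w c l) = 0 := by
    rw [subst_conjProduct]
    exact List.prod_eq_zero (List.mem_map.2 ⟨i, hi, by
      rw [hgi, map_one, sub_self, mul_zero, zero_mul]⟩)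
  rw [hzero, map_zero, LinearMap.zero_apply]

theorem lift_eq_of_mem_closure {g g' : ℕ → G} {S : Set ℕ} (h : Set.EqOn g g' S) {w : F}
    (hw : w ∈ Subgroup.closure (X '' S)) : FreeGroup.lift g w = FreeGroup.lift g' w := by
  refine MonoidHom.eqOn_closure ?_ hw
  rintro _ ⟨i, hi, rfl⟩
  simpa using h hi

theorem IsPrimeIdeal.satisfiesDisjunction {P : Ideal K[G]} [P.IsTwoSided] (hP : IsPrimeIdeal P)
    {w : ι → F} {c : ι → ℕ} (hc : Function.Injective c)
    (hw : ∀ i, w i ∈ Subgroup.closure (X '' (Set.range c)ᶜ)) {l : List ι} (hl : l.Nodup)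
    (h : HasValuesIn (conjProduct K w c l) P) :
    SatisfiesDisjunction (G ⧸ congruenceKer P) w l := by
  intro q
  choose x hx using fun n => QuotientGroup.mk_surjective (q n)
  obtain ⟨i, hi, hmem⟩ := hP.exists_mem_of_prod_conj
    (fun i => of K G (FreeGroup.lift x (w i)) - 1) hl fun y => by
      have hlift (i : ι) : FreeGroup.lift (Function.extend c y x) (w i) = FreeGroup.lift x (w i) :=
        lift_eq_of_mem_closure (fun n hn => Function.extend_apply' _ _ _ hn) (hw i)
      simpa only [subst_conjProduct, hc.extend_apply, hlift] using h (Function.extend c y x)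
  refine ⟨i, hi, ?_⟩
  have hq : (QuotientGroup.mk' (congruenceKer P)).comp (FreeGroup.lift x) = FreeGroup.lift q := by
    ext n
    simpa using hx n
  rw [← hq]
  exact (QuotientGroup.eq_one_iff _).2 (mem_congruenceKer.2 hmem)

theorem pow_eq_one_of_hasValuesIn {P : Ideal K[G]} [P.IsTwoSided] {e : ℕ}
    (h : HasValuesIn (minusOne K (X 0 ^ e)) P) (q : G ⧸ congruenceKer P) : q ^ e = 1 := by
  obtain ⟨x, rfl⟩ := QuotientGroup.mk_surjective q
  refine (QuotientGroup.eq_one_iff (x ^ e)).2 (mem_congruenceKer.2 ?_)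
  simpa [subst_minusOne] using h fun _ => x

end ConjProduct

section Words

variable {Q : Type*} [Group Q]

/-- The words `xᵢ xⱼ⁻¹` whose conjugates occur in `omegaStar`. -/
def omegaWord (p : Fin 9 × Fin 9) : F :=
  X p.1 * (X p.2)⁻¹

/-- The number of the letter `yᵢⱼ` in `omegaStar`. -/
def omegaLetter (p : Fin 9 × Fin 9) : ℕ :=
  9 + 9 * (p.1 : ℕ) + (p.2 : ℕ)

/-- The words whose conjugates occur in `threeStar`. -/
def threeWord : Fin 6 → F :=
  ![X 1 ^ 2, X 2 ^ 2, X 3 ^ 2, X 1 * (X 2)⁻¹, X 1 * (X 3)⁻¹, X 2 * (X 3)⁻¹]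

/-- The number of the letter `yᵢ₊₁` in `threeStar`. -/
def threeLetter (i : Fin 6) : ℕ :=
  4 + i

theorem omegaLetter_injective : Function.Injective omegaLetter := by
  rintro ⟨i, j⟩ ⟨i', j'⟩ h
  simp only [omegaLetter] at h
  ext <;> dsimp only <;> omega

theorem threeLetter_injective : Function.Injective threeLetter := fun _ _ h =>
  Fin.ext (Nat.add_left_cancel h)

theorem omegaWord_mem_closure (p : Fin 9 × Fin 9) :
    omegaWord p ∈ Subgroup.closure (X '' (Set.range omegaLetter)ᶜ) := by
  have hX (i : Fin 9) : X i ∈ Subgroup.closure (X '' (Set.range omegaLetter)ᶜ) := by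
    refine Subgroup.subset_closure ⟨i, ?_, rfl⟩
    rintro ⟨p, hp⟩
    simp only [omegaLetter] at hp
    omega
  exact mul_mem (hX _) (inv_mem (hX _))

theorem threeWord_mem_closure (i : Fin 6) :
    threeWord i ∈ Subgroup.closure (X '' (Set.range threeLetter)ᶜ) := by
  have hX (j : ℕ) (hj : j < 4) : X j ∈ Subgroup.closure (X '' (Set.range threeLetter)ᶜ) := by
    refine Subgroup.subset_closure ⟨j, ?_, rfl⟩
    rintro ⟨i, rfl⟩
    simp only [threeLetter] at hj
    omega
  have h1 := hX 1 (by norm_num)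
  have h2 := hX 2 (by norm_num)
  have h3 := hX 3 (by norm_num)
  fin_cases i
  exacts [pow_mem h1 2, pow_mem h2 2, pow_mem h3 2, mul_mem h1 (inv_mem h2),
    mul_mem h1 (inv_mem h3), mul_mem h2 (inv_mem h3)]

theorem omegaStar_eq_conjProduct (K : Type*) [Field K] (l : List (Fin 9 × Fin 9)) :
    omegaStar K l = conjProduct K omegaWord omegaLetter l :=
  rfl

theorem threeStar_eq_conjProduct (K : Type*) [Field K] :
    threeStar K = conjProduct K threeWord threeLetter (List.finRange 6) := by
  simp [threeStar, conjProduct, threeWord, threeLetter, List.finRange_succ, mul_assoc]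

theorem satisfiesDisjunction_omegaWord_iff {l : List (Fin 9 × Fin 9)}
    (hmem : ∀ p : Fin 9 × Fin 9, p ∈ l ↔ p.1 < p.2) :
    SatisfiesDisjunction Q omegaWord l ↔ ∀ q : Fin 9 → Q, ¬ Function.Injective q := by
  have hlift (q : ℕ → Q) (p : Fin 9 × Fin 9) :
      FreeGroup.lift q (omegaWord p) = 1 ↔ q p.1 = q p.2 := by
    simp [omegaWord, mul_inv_eq_one]
  simp only [SatisfiesDisjunction, hlift, hmem]
  refine ⟨fun h q hq => ?_, fun h q => ?_⟩
  · obtain ⟨p, hp, hqp⟩ := h fun n => q (Fin.ofNat 9 n)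
    exact hp.ne (hq (by simpa using hqp))
  · obtain ⟨i, j, hij, hne⟩ := Function.not_injective_iff.1 (h fun i => q i)
    rcases hne.lt_or_gt with hlt | hlt
    exacts [⟨(i, j), hlt, hij⟩, ⟨(j, i), hlt, hij.symm⟩]

theorem satisfiesDisjunction_threeWord_iff :
    SatisfiesDisjunction Q threeWord (List.finRange 6) ↔
      ∀ x y z : Q, x ^ 2 = 1 ∨ y ^ 2 = 1 ∨ z ^ 2 = 1 ∨ x = y ∨ x = z ∨ y = z := by
  have hlift (q : ℕ → Q) : (∃ i ∈ List.finRange 6, FreeGroup.lift q (threeWord i) = 1) ↔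
      q 1 ^ 2 = 1 ∨ q 2 ^ 2 = 1 ∨ q 3 ^ 2 = 1 ∨ q 1 = q 2 ∨ q 1 = q 3 ∨ q 2 = q 3 := by
    simp [Fin.exists_fin_succ, threeWord, mul_inv_eq_one]
  simp only [SatisfiesDisjunction, hlift]
  exact ⟨fun h x y z => h fun | 1 => x | 2 => y | _ => z, fun h q => h (q 1) (q 2) (q 3)⟩

end Words

section Group

variable {Q : Type*} [Group Q]

theorem forall_not_injective_iff {α : Type*} {n : ℕ} :
    (∀ q : Fin (n + 1) → α, ¬ Function.Injective q) ↔ Finite α ∧ Nat.card α ≤ n := by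
  refine ⟨fun h => ?_, fun ⟨_, hn⟩ q hq => ?_⟩
  · have hα : Finite α := by
      by_contra hα
      have := not_finite_iff_infinite.1 hα
      exact h _ ((Infinite.natEmbedding α).injective.comp Fin.val_injective)
    refine ⟨hα, ?_⟩
    by_contra! hn
    exact h _ ((Finite.equivFin α).symm.injective.comp (Fin.castLE_injective hn))
  · have hle := Nat.card_le_card_of_injective q hq
    rw [Nat.card_fin] at hle
    exact Nat.not_succ_le_self n (hle.trans hn)

theorem exists_injective_monoidHom_of_isCyclic [IsCyclic Q] {H : Type*} [Group H] {a : H}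
    (ha : orderOf a ≠ 0) (hQ : ∀ x : Q, x ^ orderOf a = 1) :
    ∃ e : Q →* H, Function.Injective e := by
  have hdvd : Nat.card Q ∣ orderOf a :=
    IsCyclic.exponent_eq_card (α := Q) ▸ Monoid.exponent_dvd_of_forall_pow_eq_one hQ
  have hcard : Nat.card Q = Nat.card (Subgroup.zpowers (a ^ (orderOf a / Nat.card Q))) := by
    rw [Nat.card_zpowers, orderOf_pow_orderOf_div ha hdvd]
  exact ⟨(Subgroup.subtype _).comp (mulEquivOfCyclicCardEq hcard).toMonoidHom,
    Subtype.val_injective.comp (MulEquiv.injective _)⟩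

theorem isCyclic_of_forall_sq_eq_one [IsCyclic (Subgroup.center Q)] (h : ∀ x : Q, x ^ 2 = 1) :
    IsCyclic Q := by
  have htop : Subgroup.center Q = ⊤ := (Subgroup.eq_top_iff' _).2 fun x =>
    Subgroup.mem_center_iff.2 fun y =>
      Commute.of_orderOf_dvd_two (fun z => orderOf_dvd_of_pow_eq_one (h z)) y x
  exact isCyclic_of_surjective (Subgroup.center Q).subtype fun x => ⟨⟨x, htop ▸ trivial⟩, rfl⟩

section DihedralLift

variable {n : ℕ} {a s : Q}

/-- The homomorphism `i ↦ a ^ i` from `ℤ/n` given by an element whose `n`-th power is trivial. -/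
def zmodPow (a : Q) (ha : a ^ n = 1) : Multiplicative (ZMod n) →* Q :=
  AddMonoidHom.toMultiplicativeLeft <| ZMod.lift n
    ⟨zmultiplesHom (Additive Q) (Additive.ofMul a), by simp [← ofMul_pow, ha]⟩

theorem zmodPow_ofAdd_intCast (ha : a ^ n = 1) (k : ℤ) :
    zmodPow a ha (.ofAdd (k : ZMod n)) = a ^ k := by
  simp [zmodPow]

theorem zmodPow_mem_zpowers (ha : a ^ n = 1) (i : Multiplicative (ZMod n)) :
    zmodPow a ha i ∈ Subgroup.zpowers a := by
  obtain ⟨k, hk⟩ := ZMod.intCast_surjective i.toAdd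
  rw [← ofAdd_toAdd i, ← hk, zmodPow_ofAdd_intCast]
  exact zpow_mem (Subgroup.mem_zpowers a) k

theorem zmodPow_injective (ha : orderOf a = n) :
    Function.Injective (zmodPow a (ha ▸ pow_orderOf_eq_one a)) := by
  refine (injective_iff_map_eq_one _).2 fun i hi => ?_
  obtain ⟨k, hk⟩ := ZMod.intCast_surjective i.toAdd
  rw [← ofAdd_toAdd i, ← hk] at hi ⊢
  rw [zmodPow_ofAdd_intCast, ← orderOf_dvd_iff_zpow_eq_one, ha] at hi
  rw [(ZMod.intCast_zmod_eq_zero_iff_dvd k n).2 hi, ofAdd_zero]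

theorem zmodPow_mul (ha : a ^ n = 1) (has : a * s = s * a⁻¹) (i : Multiplicative (ZMod n)) :
    zmodPow a ha i * s = s * (zmodPow a ha i)⁻¹ := by
  obtain ⟨k, hk⟩ := ZMod.intCast_surjective i.toAdd
  have hconj : SemiconjBy s a⁻¹ a := has.symm
  rw [← ofAdd_toAdd i, ← hk, zmodPow_ofAdd_intCast, ← inv_zpow]
  exact (hconj.zpow_right k).symm

/-- The homomorphism from the dihedral group of order `2 n` given by two elements satisfying its
defining relations. -/
def dihedralLift (a s : Q) (ha : a ^ n = 1) (hs : s ^ 2 = 1) (has : a * s = s * a⁻¹) :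
    DihedralGroup n →* Q where
  toFun
    | .r i => zmodPow a ha (.ofAdd i)
    | .sr i => s * zmodPow a ha (.ofAdd i)
  map_one' := map_one (zmodPow a ha)
  map_mul' := by
    have hss : s * s = 1 := by rw [← pow_two, hs]
    have hswap := zmodPow_mul ha has
    rintro (i | i) (j | j)
    · simp only [DihedralGroup.r_mul_r, ofAdd_add, map_mul]
    · simp only [DihedralGroup.r_mul_sr, sub_eq_neg_add, ofAdd_add, ofAdd_neg, map_mul, map_inv,
        ← mul_assoc, hswap]
    · simp only [DihedralGroup.sr_mul_r, ofAdd_add, map_mul, mul_assoc]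
    · rw [mul_assoc s, ← mul_assoc _ s, hswap, ← mul_assoc, ← mul_assoc, hss]
      simp only [DihedralGroup.sr_mul_sr, sub_eq_neg_add, ofAdd_add, ofAdd_neg, map_mul, map_inv,
        one_mul]

theorem dihedralLift_injective (ha : orderOf a = n) (hs : s ^ 2 = 1) (has : a * s = s * a⁻¹)
    (hmem : s ∉ Subgroup.zpowers a) :
    Function.Injective (dihedralLift a s (ha ▸ pow_orderOf_eq_one a) hs has) := by
  refine (injective_iff_map_eq_one _).2 ?_
  rintro (i | i) hi
  · exact congrArg DihedralGroup.r ((map_eq_one_iff _ (zmodPow_injective ha)).1 hi)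
  · refine absurd ?_ hmem
    rw [eq_inv_of_mul_eq_one_left hi]
    exact inv_mem (zmodPow_mem_zpowers _ _)

end DihedralLift

theorem sq_eq_one_of_notMem_zpowers {a s : Q}
    (h : ∀ x y z : Q, x ^ 2 = 1 ∨ y ^ 2 = 1 ∨ z ^ 2 = 1 ∨ x = y ∨ x = z ∨ y = z)
    (ha : a ^ 2 ≠ 1) (hs : s ∉ Subgroup.zpowers a) : s ^ 2 = 1 := by
  have hinv : a ≠ a⁻¹ := fun h => ha (by rw [pow_two, ← eq_inv_iff_mul_eq_one, ← h])
  rcases h a a⁻¹ s with h | h | h | h | rfl | rfl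
  · exact absurd h ha
  · exact absurd (by simpa using h) ha
  · exact h
  · exact absurd h hinv
  · exact absurd (Subgroup.mem_zpowers a) hs
  · exact absurd (inv_mem (Subgroup.mem_zpowers a)) hs

theorem exists_injective_dihedralGroup_four [Finite Q] (hcard : Nat.card Q ≤ 8)
    (hexp : ∀ x : Q, x ^ 4 = 1)
    (hthree : ∀ x y z : Q, x ^ 2 = 1 ∨ y ^ 2 = 1 ∨ z ^ 2 = 1 ∨ x = y ∨ x = z ∨ y = z)
    [IsCyclic (Subgroup.center Q)] :
    ∃ e : Q →* DihedralGroup 4, Function.Injective e := by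
  have hr : orderOf (.r 1 : DihedralGroup 4) = 4 := DihedralGroup.orderOf_r_one
  by_cases hQ : IsCyclic Q
  · exact exists_injective_monoidHom_of_isCyclic (a := .r 1) (by rw [hr]; norm_num) (by rwa [hr])
  obtain ⟨a, ha⟩ : ∃ a : Q, a ^ 2 ≠ 1 := by
    contrapose! hQ
    exact isCyclic_of_forall_sq_eq_one hQ
  have hord : orderOf a = 4 := orderOf_eq_prime_pow (p := 2) (n := 1) ha (hexp a)
  obtain ⟨s, hs⟩ : ∃ s, s ∉ Subgroup.zpowers a := by
    contrapose! hQ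
    exact ⟨a, hQ⟩
  have hs2 : s * s = 1 := pow_two s ▸ sq_eq_one_of_notMem_zpowers hthree ha hs
  have has2 : (a * s) * (a * s) = 1 := pow_two (a * s) ▸ sq_eq_one_of_notMem_zpowers hthree ha
    fun h => hs ((Subgroup.mul_mem_cancel_left _ (Subgroup.mem_zpowers a)).1 h)
  have has : a * s = s * a⁻¹ := by
    rw [mul_eq_one_iff_eq_inv.1 has2, mul_inv_rev, inv_eq_of_mul_eq_one_left hs2]
  have hinj := dihedralLift_injective hord (pow_two s ▸ hs2) has hs
  have hbij := hinj.bijective_of_nat_card_le (by rwa [DihedralGroup.nat_card])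
  exact ⟨(MulEquiv.ofBijective _ hbij).symm.toMonoidHom, MulEquiv.injective _⟩

end Group

section DihedralFour

theorem pow_four_eq_one_dihedralGroup_four (x : DihedralGroup 4) : x ^ 4 = 1 := by
  revert x
  decide

theorem sq_eq_one_or_eq_dihedralGroup_four (x y z : DihedralGroup 4) :
    x ^ 2 = 1 ∨ y ^ 2 = 1 ∨ z ^ 2 = 1 ∨ x = y ∨ x = z ∨ y = z := by
  have hsq : ∀ x : DihedralGroup 4, x ^ 2 = 1 ∨ x = .r 1 ∨ x = .r 3 := by decide
  rcases hsq x with hx | rfl | rfl <;> rcases hsq y with hy | rfl | rfl <;>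
    rcases hsq z with hz | rfl | rfl <;> simp_all

variable {K : Type*} [Field K] {l : List (Fin 9 × Fin 9)}

theorem subset_identitiesOf_leftRegular_dihedralGroup_four
    (hmem : ∀ p : Fin 9 × Fin 9, p ∈ l ↔ p.1 < p.2) :
    {omegaStar K l, expStar K, threeStar K} ⊆
      identitiesOf (Representation.leftRegular K (DihedralGroup 4)) := by
  rintro u (rfl | rfl | rfl)
  · rw [omegaStar_eq_conjProduct]
    refine SatisfiesDisjunction.conjProduct_mem_identitiesOf ?_ omegaLetter _
    rw [satisfiesDisjunction_omegaWord_iff hmem, forall_not_injective_iff, DihedralGroup.nat_card]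
    exact ⟨inferInstance, le_rfl⟩
  · refine isIdentity_leftRegular_iff.2 fun g => ?_
    simp [expStar, subst_minusOne, pow_four_eq_one_dihedralGroup_four, -MonoidAlgebra.of_apply]
  · rw [threeStar_eq_conjProduct]
    exact (satisfiesDisjunction_threeWord_iff.2
      sq_eq_one_or_eq_dihedralGroup_four).conjProduct_mem_identitiesOf threeLetter _

theorem IsPrimeIdeal.exists_monoidHom_dihedralGroup_four {G : Type*} [Group G]
    {P : Ideal K[G]} [P.IsTwoSided] (hP : IsPrimeIdeal P) (hl : l.Nodup)
    (hmem : ∀ p : Fin 9 × Fin 9, p ∈ l ↔ p.1 < p.2) (homega : HasValuesIn (omegaStar K l) P)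
    (hexp : HasValuesIn (expStar K) P) (hthree : HasValuesIn (threeStar K) P) :
    ∃ f : G →* DihedralGroup 4, ∀ g ∈ f.ker, MonoidAlgebra.of K G g - 1 ∈ P := by
  rw [omegaStar_eq_conjProduct] at homega
  have hinj := (satisfiesDisjunction_omegaWord_iff hmem).1
    (hP.satisfiesDisjunction omegaLetter_injective omegaWord_mem_closure hl homega)
  obtain ⟨_, hcard⟩ := forall_not_injective_iff.1 hinj
  rw [threeStar_eq_conjProduct] at hthree
  have hthree' := satisfiesDisjunction_threeWord_iff.1 (hP.satisfiesDisjunction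
    threeLetter_injective threeWord_mem_closure (List.nodup_finRange 6) hthree)
  have := hP.isCyclic_center_quotient
  obtain ⟨e, he⟩ :=
    exists_injective_dihedralGroup_four hcard (pow_eq_one_of_hasValuesIn hexp) hthree'
  refine ⟨e.comp (QuotientGroup.mk' _), fun g hg => mem_congruenceKer.1 ?_⟩
  exact (QuotientGroup.eq_one_iff g).1 ((map_eq_one_iff e he).1 hg)

end DihedralFour

end RepIdentities

theorem proposition5 (K : Type uK) [Field K] (hK : ringChar K ≠ 2)
    (l : List (Fin 9 × Fin 9)) (hl : l.Nodup) (hmem : ∀ p : Fin 9 × Fin 9, p ∈ l ↔ p.1 < p.2) :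
    RepIdentities.IsBasisOfIdentities.{uK, 0, uK, uG, uV}
      (Representation.leftRegular K (DihedralGroup 4))
      {RepIdentities.omegaStar K l, RepIdentities.expStar K, RepIdentities.threeStar K} := by
  have h2 : (2 : K) ≠ 0 := Ring.two_ne_zero hK
  have h4 : ((4 : ℕ) : K) ≠ 0 := by exact_mod_cast mul_ne_zero h2 h2
  have h8 : (Nat.card (DihedralGroup 4) : K) ≠ 0 := by
    rw [DihedralGroup.nat_card]
    exact_mod_cast mul_ne_zero h2 h4
  refine RepIdentities.isBasisOfIdentities_leftRegular h8
    (RepIdentities.subset_identitiesOf_leftRegular_dihedralGroup_four hmem) h4 ?_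
    fun n P _ hP hvalues => ?_
  · exact Or.inr (Or.inl rfl)
  · exact hP.exists_monoidHom_dihedralGroup_four hl hmem (hvalues _ (by simp))
      (hvalues _ (by simp)) (hvalues _ (by simp))
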